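/- Let $K(k)=\int_0^{\pi/2}\frac{dt}{\sqrt{1-k^2\sin^2 t}}$, put $a=2K(1/2)$, and let $\mathbb K$ be the Klein bottle obtained as the quotient of $\mathbb R^2$ by the group of motions generated by $(x,y)\mapsto(x+\pi,-y)$ and $(x,y)\mapsto(x,y+a)$. Let $\theta:\mathbb R\to\mathbb R$ be the inverse function of $$\theta\mapsto y=\frac12\int_0^\theta\frac{dt}{\sqrt{1-\frac14\cos^2 t}},$$ and set $$\varphi_0(y)=\sqrt{\tfrac58}\,\cos\theta(y),\qquad \varphi_1(y)=\tfrac1{\sqrt2}\,\sin\theta(y),\qquad \varphi_2(y)=\sqrt{\tfrac{3+\sin^2\theta(y)}{8}}.$$ (Equivalently, $(\varphi_1,\varphi_2)$ is the solution of $\varphi_1''=(1-2\varphi_1^2-8\varphi_2^2)\varphi_1$, $\varphi_2''=(4-2\varphi_1^2-8\varphi_2^2)\varphi_2$ with $\varphi_1(0)=0$, $\varphi_1'(0)=2p$, $\varphi_2(0)=p$, $\varphi_2'(0)=0$, where $p=\sqrt{3/8}$, and $\varphi_0^2+\varphi_1^2+\varphi_2^2=1$.) Let $\hat g_0$ be the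 Riemannian metric on $\mathbb K$ given by $$\hat g_0=2\bigl(\varphi_1(y)^2+4\varphi_2(y)^2\bigr)(dx^2+dy^2),$$ and let $\Delta=-\frac{1}{2(\varphi_1^2+4\varphi_2^2)}\left(\partial_x^2+\partial_y^2\right)$ be its (nonnegative) Laplace–Beltrami operator, acting on smooth real functions on $\mathbb K$. Proposition 3.1. The number $\lambda=1$ is the smallest nonzero eigenvalue of $\Delta$ on $(\mathbb K,\hat g_0)$, and its eigenspace is the real linear span of the functions $$\varphi_0(y),\quad \varphi_1(y)\cos x,\quad \varphi_1(y)\sin x,\quad \varphi_2(y)\cos 2x,\quad \varphi_2(y)\sin 2x .$$ -/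

import Mathlib

namespace ExtremalKlein

/-! ### The profile functions and the period -/

/-- The complete elliptic integral of the first kind with modulus `k`. -/
noncomputable def ellipticK (k : ℝ) : ℝ :=
  ∫ t in (0 : ℝ)..(Real.pi / 2), 1 / √(1 - k ^ 2 * Real.sin t ^ 2)

/-- The period `a = 2 K(1/2)` in the variable `y`. -/
noncomputable def period : ℝ := 2 * ellipticK (1 / 2)

/-- The weight `1 / √(1 - cos² t / 4)`. -/
noncomputable def weight (t : ℝ) : ℝ := 1 / √(1 - Real.cos t ^ 2 / 4)

/-- The variable `y` as a function of the angle: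
`y = (1/2) ∫_0^θ dt / √(1 - cos² t / 4)`. -/
noncomputable def yOfAngle (s : ℝ) : ℝ := 1 / 2 * ∫ t in (0 : ℝ)..s, weight t

lemma weight_arg_pos (t : ℝ) : 0 < 1 - Real.cos t ^ 2 / 4 := by
  nlinarith [Real.cos_sq_le_one t]

lemma one_le_weight (t : ℝ) : 1 ≤ weight t := by
  have h : 0 < √(1 - Real.cos t ^ 2 / 4) := Real.sqrt_pos.2 (weight_arg_pos t)
  rw [weight, le_div_iff₀ h, one_mul, Real.sqrt_le_iff]
  refine ⟨zero_le_one, ?_⟩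
  nlinarith [sq_nonneg (Real.cos t)]

lemma continuous_weight : Continuous weight := by
  unfold weight
  refine Continuous.div (by fun_prop) (by fun_prop) fun t => ?_
  exact (Real.sqrt_pos.2 (weight_arg_pos t)).ne'

lemma hasDerivAt_yOfAngle (s : ℝ) : HasDerivAt yOfAngle (1 / 2 * weight s) s :=
  (continuous_weight.integral_hasStrictDerivAt 0 s).hasDerivAt.const_mul (1 / 2)

lemma continuous_yOfAngle : Continuous yOfAngle :=
  continuous_iff_continuousAt.2 fun s => (hasDerivAt_yOfAngle s).continuousAt

lemma strictMono_yOfAngle : StrictMono yOfAngle := by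
  refine strictMono_of_deriv_pos fun s => ?_
  rw [(hasDerivAt_yOfAngle s).deriv]
  linarith [one_le_weight s]

lemma yOfAngle_zero : yOfAngle 0 = 0 := by simp [yOfAngle]

lemma yOfAngle_neg (s : ℝ) : yOfAngle (-s) = -yOfAngle s := by
  have h := intervalIntegral.integral_comp_neg (a := 0) (b := s) weight
  have e : (fun t => weight (-t)) = weight := by
    funext t; simp [weight]
  rw [e, neg_zero] at h
  rw [yOfAngle, yOfAngle, h, intervalIntegral.integral_symm]
  ring

lemma half_le_yOfAngle {s : ℝ} (hs : 0 ≤ s) : s / 2 ≤ yOfAngle s := by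
  have h : ∫ _ in (0 : ℝ)..s, (1 : ℝ) ≤ ∫ t in (0 : ℝ)..s, weight t :=
    intervalIntegral.integral_mono_on hs (by simp)
      (continuous_weight.intervalIntegrable _ _) fun t _ => one_le_weight t
  simp only [intervalIntegral.integral_const, sub_zero, smul_eq_mul, mul_one] at h
  unfold yOfAngle
  linarith

lemma tendsto_yOfAngle_atTop : Filter.Tendsto yOfAngle Filter.atTop Filter.atTop := by
  refine Filter.tendsto_atTop_mono' _ ?_
    (Filter.tendsto_id.atTop_div_const (two_pos : (0 : ℝ) < 2))
  filter_upwards [Filter.eventually_ge_atTop 0] with s hs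
  exact half_le_yOfAngle hs

lemma bijective_yOfAngle : Function.Bijective yOfAngle := by
  refine ⟨strictMono_yOfAngle.injective,
    continuous_yOfAngle.surjective tendsto_yOfAngle_atTop ?_⟩
  have h := Filter.tendsto_neg_atTop_atBot.comp
    (tendsto_yOfAngle_atTop.comp Filter.tendsto_neg_atBot_atTop)
  refine h.congr fun s => ?_
  simp [yOfAngle_neg]

/-- The angle function `θ`, the inverse function of `θ ↦ y`. -/
noncomputable def angle : ℝ → ℝ := (Equiv.ofBijective yOfAngle bijective_yOfAngle).symm

noncomputable def phi0 (y : ℝ) : ℝ := √(5 / 8) * Real.cos (angle y)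

noncomputable def phi1 (y : ℝ) : ℝ := 1 / √2 * Real.sin (angle y)

/-- The positive function with `4 φ₂² - φ₁² = 3/2`. -/
noncomputable def phi2 (y : ℝ) : ℝ := √((3 + Real.sin (angle y) ^ 2) / 8)

/-- The conformal factor `2 (φ₁² + 4 φ₂²)` of the normalized metric. -/
noncomputable def conformalFactor (y : ℝ) : ℝ := 2 * (phi1 y ^ 2 + 4 * phi2 y ^ 2)

/-! ### Parity and periodicity of the profile functions -/

lemma yOfAngle_angle (y : ℝ) : yOfAngle (angle y) = y :=
  (Equiv.ofBijective yOfAngle bijective_yOfAngle).apply_symm_apply y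

lemma angle_eq_of {s y : ℝ} (h : yOfAngle s = y) : angle y = s :=
  strictMono_yOfAngle.injective (by rw [yOfAngle_angle, h])

lemma angle_zero : angle 0 = 0 := angle_eq_of yOfAngle_zero

lemma angle_neg (y : ℝ) : angle (-y) = -angle y :=
  angle_eq_of (by rw [yOfAngle_neg, yOfAngle_angle])

lemma weight_periodic : Function.Periodic weight Real.pi := fun t => by
  simp [weight, Real.cos_add_pi]

lemma integral_weight_half : ∫ t in (0 : ℝ)..(Real.pi / 2), weight t = ellipticK (1 / 2) := by
  have h := intervalIntegral.integral_comp_sub_left (a := 0) (b := Real.pi / 2) weight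
    (Real.pi / 2)
  rw [sub_self, sub_zero] at h
  rw [← h, ellipticK]
  refine intervalIntegral.integral_congr fun t _ => ?_
  simp only [weight, Real.cos_pi_div_two_sub]
  ring_nf

lemma yOfAngle_pi : yOfAngle Real.pi = ellipticK (1 / 2) := by
  have h := weight_periodic.intervalIntegral_add_eq 0 (-(Real.pi / 2))
  rw [zero_add, show -(Real.pi / 2) + Real.pi = Real.pi / 2 by ring,
    ← intervalIntegral.integral_add_adjacent_intervals (a := -(Real.pi / 2)) (b := 0)
      (continuous_weight.intervalIntegrable _ _) (continuous_weight.intervalIntegrable _ _),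
    integral_weight_half] at h
  have h2 := yOfAngle_neg (Real.pi / 2)
  simp only [yOfAngle, integral_weight_half] at h2
  rw [intervalIntegral.integral_symm] at h2
  rw [yOfAngle, h]
  linarith

lemma yOfAngle_add_pi (s : ℝ) : yOfAngle (s + Real.pi) = yOfAngle s + ellipticK (1 / 2) := by
  rw [← yOfAngle_pi]
  have h := weight_periodic.intervalIntegral_add_eq s 0
  rw [zero_add] at h
  simp only [yOfAngle]
  rw [← intervalIntegral.integral_add_adjacent_intervals (b := s)
      (continuous_weight.intervalIntegrable _ _) (continuous_weight.intervalIntegrable _ _), h]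
  ring

lemma angle_add_period (y : ℝ) : angle (y + period) = angle y + 2 * Real.pi := by
  apply angle_eq_of
  rw [two_mul, ← add_assoc, yOfAngle_add_pi, yOfAngle_add_pi, yOfAngle_angle, period]
  ring

lemma phi0_neg (y : ℝ) : phi0 (-y) = phi0 y := by simp [phi0, angle_neg]
lemma phi1_neg (y : ℝ) : phi1 (-y) = -phi1 y := by simp [phi1, angle_neg]
lemma phi2_neg (y : ℝ) : phi2 (-y) = phi2 y := by simp [phi2, angle_neg]
lemma phi0_add_period (y : ℝ) : phi0 (y + period) = phi0 y := by simp [phi0, angle_add_period]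
lemma phi1_add_period (y : ℝ) : phi1 (y + period) = phi1 y := by simp [phi1, angle_add_period]
lemma phi2_add_period (y : ℝ) : phi2 (y + period) = phi2 y := by simp [phi2, angle_add_period]

/-! ### The profile functions solve the defining initial value problem -/

lemma continuous_angle : Continuous angle := by
  have h : StrictMono angle := fun x y hxy => by
    rw [← strictMono_yOfAngle.lt_iff_lt, yOfAngle_angle, yOfAngle_angle]; exact hxy
  exact h.monotone.continuous_of_surjective
    (Equiv.ofBijective yOfAngle bijective_yOfAngle).symm.surjective

lemma hasDerivAt_angle (y : ℝ) : HasDerivAt angle (√(3 + Real.sin (angle y) ^ 2)) y := by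
  have hp := one_le_weight (angle y)
  have h := (hasDerivAt_yOfAngle (angle y)).of_local_left_inverse (f := yOfAngle)
    continuous_angle.continuousAt (by positivity)
    (Filter.Eventually.of_forall yOfAngle_angle)
  refine h.congr_deriv ?_
  have e : 3 + Real.sin (angle y) ^ 2 = 2 ^ 2 * (1 - Real.cos (angle y) ^ 2 / 4) := by
    rw [Real.sin_sq]; ring
  rw [e, Real.sqrt_mul (by norm_num), Real.sqrt_sq (by norm_num), weight]
  simp [mul_comm]

lemma hasDerivAt_deriv_angle (y : ℝ) :
    HasDerivAt (fun z => √(3 + Real.sin (angle z) ^ 2))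
      (Real.sin (angle y) * Real.cos (angle y)) y := by
  have hpos : 0 < 3 + Real.sin (angle y) ^ 2 := by positivity
  have h := ((((Real.hasDerivAt_sin _).comp y (hasDerivAt_angle y)).pow 2).const_add 3).sqrt
    hpos.ne'
  refine h.congr_deriv ?_
  change ((2 : ℕ) : ℝ) * Real.sin (angle y) ^ (2 - 1) *
    (Real.cos (angle y) * √(3 + Real.sin (angle y) ^ 2)) /
      (2 * √(3 + Real.sin (angle y) ^ 2)) = _
  have hne := (Real.sqrt_pos.2 hpos).ne'
  push_cast
  field_simp

lemma phi2_eq (y : ℝ) : phi2 y = 1 / √8 * √(3 + Real.sin (angle y) ^ 2) := by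
  rw [phi2, Real.sqrt_div (by positivity)]; ring

lemma phi1_sq (y : ℝ) : phi1 y ^ 2 = Real.sin (angle y) ^ 2 / 2 := by
  rw [phi1, mul_pow, div_pow, Real.sq_sqrt (by norm_num)]; ring

lemma phi2_sq (y : ℝ) : phi2 y ^ 2 = (3 + Real.sin (angle y) ^ 2) / 8 := by
  rw [phi2, Real.sq_sqrt (by positivity)]

lemma sum_sq_phi (y : ℝ) : phi0 y ^ 2 + phi1 y ^ 2 + phi2 y ^ 2 = 1 := by
  rw [phi1_sq, phi2_sq, phi0, mul_pow, Real.sq_sqrt (by norm_num), Real.cos_sq']; ring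

/-- `φ₁'' = (1 - 2φ₁² - 8φ₂²) φ₁`, `φ₂'' = (4 - 2φ₁² - 8φ₂²) φ₂`, with `φ₁(0) = 0`,
`φ₁'(0) = 2p`, `φ₂(0) = p`, `φ₂'(0) = 0` for `p = √(3/8)`. -/
lemma phi_system : ∃ d1 d2 : ℝ → ℝ,
    (∀ y, HasDerivAt phi1 (d1 y) y) ∧ (∀ y, HasDerivAt phi2 (d2 y) y) ∧
    (∀ y, HasDerivAt d1 ((1 - 2 * phi1 y ^ 2 - 8 * phi2 y ^ 2) * phi1 y) y) ∧
    (∀ y, HasDerivAt d2 ((4 - 2 * phi1 y ^ 2 - 8 * phi2 y ^ 2) * phi2 y) y) ∧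
    phi1 0 = 0 ∧ d1 0 = 2 * √(3 / 8) ∧ phi2 0 = √(3 / 8) ∧ d2 0 = 0 := by
  refine ⟨fun y => 1 / √2 * (Real.cos (angle y) * √(3 + Real.sin (angle y) ^ 2)),
    fun y => 1 / √8 * (Real.sin (angle y) * Real.cos (angle y)), fun y => ?_, fun y => ?_,
    fun y => ?_, fun y => ?_, ?_, ?_, ?_, ?_⟩
  · exact ((Real.hasDerivAt_sin _).comp y (hasDerivAt_angle y)).const_mul _
  · have h := (hasDerivAt_deriv_angle y).const_mul (1 / √8)
    exact h.congr_of_eventuallyEq (Filter.Eventually.of_forall phi2_eq)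
  · have h := ((((Real.hasDerivAt_cos _).comp y (hasDerivAt_angle y)).mul
      (hasDerivAt_deriv_angle y))).const_mul (1 / √2)
    refine h.congr_deriv ?_
    have e : √(3 + Real.sin (angle y) ^ 2) ^ 2 = 3 + Real.sin (angle y) ^ 2 :=
      Real.sq_sqrt (by positivity)
    rw [phi1_sq, phi2_sq, phi1]
    simp only [Function.comp_apply]
    linear_combination (1 / √2 * Real.sin (angle y)) * (Real.sin_sq_add_cos_sq (angle y) - e)
  · have h := ((((Real.hasDerivAt_sin _).comp y (hasDerivAt_angle y)).mul
      ((Real.hasDerivAt_cos _).comp y (hasDerivAt_angle y)))).const_mul (1 / √8)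
    refine h.congr_deriv ?_
    rw [phi1_sq, phi2_sq, phi2_eq]
    simp only [Function.comp_apply]
    linear_combination (1 / √8 * √(3 + Real.sin (angle y) ^ 2)) *
      (Real.sin_sq_add_cos_sq (angle y))
  · simp [phi1, angle_zero]
  · rw [show (3 : ℝ) / 8 = 3 / (2 * 2 ^ 2) by norm_num]
    simp [angle_zero, Real.sqrt_div]
    ring
  · simp [phi2, angle_zero]
  · simp [angle_zero]

/-! ### The Klein bottle -/

/-- The coordinate plane, with `x = q 0` and `y = q 1`. -/
abbrev Plane := Fin 2 → ℝ

/-- The glide reflection `(x, y) ↦ (x + π, -y)`. -/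
noncomputable def glide : Equiv.Perm Plane where
  toFun q := ![q 0 + Real.pi, -q 1]
  invFun q := ![q 0 - Real.pi, -q 1]
  left_inv q := by ext i; fin_cases i <;> simp
  right_inv q := by ext i; fin_cases i <;> simp

/-- The translation `(x, y) ↦ (x, y + a)`. -/
noncomputable def shift : Equiv.Perm Plane where
  toFun q := ![q 0, q 1 + period]
  invFun q := ![q 0, q 1 - period]
  left_inv q := by ext i; fin_cases i <;> simp
  right_inv q := by ext i; fin_cases i <;> simp

/-- The group of motions of the plane generated by the two maps above. -/
def deckGroup : Subgroup (Equiv.Perm Plane) := Subgroup.closure {glide, shift}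

/-- The Klein bottle, the quotient of the plane by the group of motions. -/
def KleinBottle : Type := MulAction.orbitRel.Quotient deckGroup Plane

/-- The covering map from the plane to the Klein bottle. -/
def proj (q : Plane) : KleinBottle := Quotient.mk (MulAction.orbitRel deckGroup Plane) q

lemma invariant_of_generators {α : Type*} {U : Plane → α} (hg : ∀ q, U (glide q) = U q)
    (hs : ∀ q, U (shift q) = U q) {γ : Equiv.Perm Plane} (hγ : γ ∈ deckGroup) :
    ∀ q, U (γ q) = U q := by
  induction hγ using Subgroup.closure_induction with
  | mem x hx =>
    rcases hx with rfl | rfl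
    · exact hg
    · exact hs
  | one => intro q; rfl
  | mul x y _ _ hx hy => intro q; rw [Equiv.Perm.mul_apply, hx, hy]
  | inv x _ hx => intro q; rw [← hx, ← Equiv.Perm.mul_apply, mul_inv_cancel, Equiv.Perm.one_apply]

/-- The function on the Klein bottle induced by a function on the plane that is invariant under
the generators of the group. -/
def descend (U : Plane → ℝ) (hg : ∀ q, U (glide q) = U q) (hs : ∀ q, U (shift q) = U q) :
    KleinBottle → ℝ :=
  Quotient.lift (s := MulAction.orbitRel deckGroup Plane) U (by
    rintro p q ⟨γ, rfl⟩
    exact invariant_of_generators hg hs γ.2 q)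

/-! ### The metric, the Laplacian and its eigenfunctions -/

/-- The matrix of `f(y) (dx² + dy²)` in the coordinates `x, y`. -/
noncomputable def metric (q : Plane) : Matrix (Fin 2) (Fin 2) ℝ :=
  Matrix.diagonal fun _ => conformalFactor (q 1)

/-- The metric is invariant under the group of motions, which acts by maps whose differential
is diagonal with entries `±1`; so it descends to the Klein bottle. -/
lemma metric_invariant {γ : Equiv.Perm Plane} (hγ : γ ∈ deckGroup) (q : Plane) :
    metric (γ q) = metric q :=
  invariant_of_generators
    (fun q => by simp [metric, glide, conformalFactor, phi1_neg, phi2_neg])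
    (fun q => by simp [metric, shift, conformalFactor, phi1_add_period, phi2_add_period]) hγ q

/-- The `i`-th partial derivative. -/
noncomputable def partialDeriv (i : Fin 2) (U : Plane → ℝ) (q : Plane) : ℝ :=
  fderiv ℝ U q (Pi.single i 1)

/-- The (nonnegative) Laplace-Beltrami operator of a Riemannian metric `g` in coordinates:
`Δ U = -(det g)^(-1/2) ∑ᵢ ∂ᵢ ((det g)^(1/2) ∑ⱼ gⁱʲ ∂ⱼ U)`. -/
noncomputable def laplaceBeltrami (g : Plane → Matrix (Fin 2) (Fin 2) ℝ) (U : Plane → ℝ)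
    (q : Plane) : ℝ :=
  -(1 / √(g q).det) *
    ∑ i, partialDeriv i (fun r => √(g r).det * ∑ j, (g r)⁻¹ i j * partialDeriv j U r) q

/-- `u` is a smooth function on the Klein bottle with `Δ u = μ u` for the metric `metric`.
Smoothness and the Laplacian are computed on the universal cover. The zero function is
included. -/
def InEigenspace (μ : ℝ) (u : KleinBottle → ℝ) : Prop :=
  ContDiff ℝ (⊤ : ℕ∞) (u ∘ proj) ∧
    ∀ q : Plane, laplaceBeltrami metric (u ∘ proj) q = μ * u (proj q)

/-- `μ` is an eigenvalue of the Laplacian on the Klein bottle with the metric `metric`. -/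
def IsEigenvalue (μ : ℝ) : Prop := ∃ u : KleinBottle → ℝ, u ≠ 0 ∧ InEigenspace μ u

/-! ### The five functions -/

/-- `φ₀(y)` -/
noncomputable def mode0 : KleinBottle → ℝ :=
  descend (fun q => phi0 (q 1)) (fun q => by simp [glide, phi0_neg])
    (fun q => by simp [shift, phi0_add_period])

/-- `φ₁(y) cos x` -/
noncomputable def mode1cos : KleinBottle → ℝ :=
  descend (fun q => phi1 (q 1) * Real.cos (q 0))
    (fun q => by simp [glide, phi1_neg, Real.cos_add_pi])
    (fun q => by simp [shift, phi1_add_period])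

/-- `φ₁(y) sin x` -/
noncomputable def mode1sin : KleinBottle → ℝ :=
  descend (fun q => phi1 (q 1) * Real.sin (q 0))
    (fun q => by simp [glide, phi1_neg, Real.sin_add_pi])
    (fun q => by simp [shift, phi1_add_period])

/-- `φ₂(y) cos 2x` -/
noncomputable def mode2cos : KleinBottle → ℝ :=
  descend (fun q => phi2 (q 1) * Real.cos (2 * q 0))
    (fun q => by simp [glide, phi2_neg, mul_add])
    (fun q => by simp [shift, phi2_add_period])

/-- `φ₂(y) sin 2x` -/
noncomputable def mode2sin : KleinBottle → ℝ :=
  descend (fun q => phi2 (q 1) * Real.sin (2 * q 0))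
    (fun q => by simp [glide, phi2_neg, mul_add])
    (fun q => by simp [shift, phi2_add_period])

end ExtremalKlein

/-! The proof separates variables and then compares solutions in the Sturm manner. The square of the
glide reflection is translation by 2π in x, so the lift of an eigenfunction expands in a Fourier
series in x. With W the conformal factor, the coefficients of index m solve f'' = (m² - μW) f
(`IsPlaneEigenfunction.isRadialMode`). They have period a, and the glide reflection forces on them
the parity (-1)^m. For μ = 1 and m = 0, 1, 2 the functions φ₀, φ₁, φ₂ are such solutions.

That nothing nonzero exists for μ < 1, μ ≠ 0, follows from Picone's identity (`picone_eq_zero`),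
with a different comparison for each range of m. For m ≥ 2 the comparison function is φ₂, positive
on the whole circle. For m = 1, oddness and periodicity make f vanish at 0 and a/2, and φ₁ is
positive between these points. For m = 0 the function f is even, so f' vanishes at 0 and a/2; f' is
compared with sin θ · θ', a multiple of φ₀'. It follows that f' = 0, and μ ≠ 0 excludes the
constants.

For μ = 1 the comparison with φ₂ still removes every m ≥ 3. For m = 0, 1, 2 the parity leaves one
free initial value at 0, so f is a multiple of φ₀, φ₁ or φ₂ by uniqueness for the linear equation
(`linear_ode_unique`). A continuous periodic function with finitely many nonzero Fourier
coefficients is a trigonometric polynomial (`eq_trig_poly_of_coeff_eq_zero`), which returns from the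
coefficients to the eigenfunction. -/

namespace ExtremalKlein

open Set Filter Topology

/-! ### Two lemmas on linear second order equations -/

/-- Uniqueness for the equation `v'' = q v` with bounded coefficient. -/
lemma linear_ode_unique {q v w : ℝ → ℝ} {C t₀ : ℝ} (hC : ∀ y, |q y| ≤ C)
    (hv : ∀ y, HasDerivAt v (w y) y) (hw : ∀ y, HasDerivAt w (q y * v y) y)
    (hv0 : v t₀ = 0) (hw0 : w t₀ = 0) (y : ℝ) : v y = 0 := by
  -- Grönwall in both directions: the energy E = v² + w² satisfies |E'| ≤ (1 + C) E, so E times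
  -- exp(-(1 + C)z) decreases and E times exp((1 + C)z) increases. Since E vanishes at `t₀`, it
  -- vanishes on either side.
  have hE : ∀ y, HasDerivAt (fun z => v z ^ 2 + w z ^ 2) (2 * (1 + q y) * (v y * w y)) y :=
    fun y => (((hv y).pow 2).add ((hw y).pow 2)).congr_deriv (by push_cast; ring)
  have hexp : ∀ k y : ℝ, HasDerivAt (fun z => Real.exp (k * z)) (Real.exp (k * y) * k) y :=
    fun k y => (((hasDerivAt_id y).const_mul k).congr_deriv (mul_one k)).exp
  have hF : ∀ k y : ℝ, HasDerivAt (fun z => Real.exp (k * z) * (v z ^ 2 + w z ^ 2))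
      (Real.exp (k * y) * (k * (v y ^ 2 + w y ^ 2) + 2 * (1 + q y) * (v y * w y))) y :=
    fun k y => ((hexp k y).mul (hE y)).congr_deriv (by ring)
  have hbound : ∀ y, |2 * (1 + q y) * (v y * w y)| ≤ (1 + C) * (v y ^ 2 + w y ^ 2) := by
    intro y
    have h1 : |1 + q y| ≤ 1 + C := by
      refine (abs_add_le _ _).trans ?_
      rw [abs_one]; linarith [hC y]
    have h2 : |2 * (v y * w y)| ≤ v y ^ 2 + w y ^ 2 := by
      rw [abs_le]; constructor <;> nlinarith [sq_nonneg (v y + w y), sq_nonneg (v y - w y)]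
    calc |2 * (1 + q y) * (v y * w y)| = |1 + q y| * |2 * (v y * w y)| := by
          rw [← abs_mul]; ring_nf
      _ ≤ _ := mul_le_mul h1 h2 (abs_nonneg _) ((abs_nonneg _).trans h1)
  have hdiff : ∀ k, Differentiable ℝ (fun z => Real.exp (k * z) * (v z ^ 2 + w z ^ 2)) :=
    fun k z => (hF k z).differentiableAt
  have key : v y ^ 2 + w y ^ 2 ≤ 0 := by
    rcases le_total t₀ y with h | h
    · have hanti : Antitone (fun z => Real.exp (-(1 + C) * z) * (v z ^ 2 + w z ^ 2)) := by
        refine antitone_of_deriv_nonpos (hdiff _) fun z => ?_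
        rw [(hF _ z).deriv]
        refine mul_nonpos_of_nonneg_of_nonpos (Real.exp_pos _).le ?_
        linarith [(abs_le.1 (hbound z)).2]
      have := hanti h
      simp only [hv0, hw0] at this
      exact nonpos_of_mul_nonpos_right (by simpa using this) (Real.exp_pos _)
    · have hmono : Monotone (fun z => Real.exp ((1 + C) * z) * (v z ^ 2 + w z ^ 2)) := by
        refine monotone_of_deriv_nonneg (hdiff _) fun z => ?_
        rw [(hF _ z).deriv]
        refine mul_nonneg (Real.exp_pos _).le ?_
        linarith [(abs_le.1 (hbound z)).1]
      have := hmono h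
      simp only [hv0, hw0] at this
      exact nonpos_of_mul_nonpos_right (by simpa using this) (Real.exp_pos _)
  nlinarith [sq_nonneg (v y), sq_nonneg (w y)]

/-- Comparison of two Sturm-Liouville systems by Picone's identity: if `ψ > 0` solves
`ψ' = A χ`, `χ' = -R ψ` and `v` solves `v' = A w`, `w' = -Q v` with `Q < R`, then `v` vanishes
as soon as the boundary terms do. -/
lemma picone_eq_zero {A Q R v w ψ χ : ℝ → ℝ} {a b : ℝ}
    (hv : ∀ y ∈ Ioo a b, HasDerivAt v (A y * w y) y)
    (hw : ∀ y ∈ Ioo a b, HasDerivAt w (-Q y * v y) y)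
    (hψ : ∀ y ∈ Ioo a b, HasDerivAt ψ (A y * χ y) y)
    (hχ : ∀ y ∈ Ioo a b, HasDerivAt χ (-R y * ψ y) y)
    (hpos : ∀ y ∈ Ioo a b, 0 < ψ y) (hA : ∀ y ∈ Ioo a b, 0 ≤ A y)
    (hQR : ∀ y ∈ Ioo a b, Q y < R y)
    (ha : Tendsto (fun y => v y * w y - v y * χ y * (v y / ψ y)) (𝓝[>] a) (𝓝 0))
    (hb : Tendsto (fun y => v y * w y - v y * χ y * (v y / ψ y)) (𝓝[<] b) (𝓝 0)) :
    ∀ y ∈ Ioo a b, v y = 0 := by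
  -- G is v w - v²χ/ψ, with v/ψ kept as one factor because it stays bounded where v and ψ vanish
  -- together at an endpoint. Its derivative is a sum of two nonnegative terms.
  set G : ℝ → ℝ := fun y => v y * w y - v y * χ y * (v y / ψ y) with hG
  have hG' : ∀ y ∈ Ioo a b, HasDerivAt G
      (A y * (w y - v y * χ y / ψ y) ^ 2 + (R y - Q y) * v y ^ 2) y := by
    intro y hy
    have hne := (hpos y hy).ne'
    refine (((hv y hy).mul (hw y hy)).sub (((hv y hy).mul (hχ y hy)).mul
      ((hv y hy).div (hψ y hy) hne))).congr_deriv ?_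
    simp only [Pi.mul_apply, Pi.div_apply]
    field_simp
    ring
  have hnn : ∀ y ∈ Ioo a b, 0 ≤ A y * (w y - v y * χ y / ψ y) ^ 2 := fun y hy =>
    mul_nonneg (hA y hy) (sq_nonneg _)
  have hmono : MonotoneOn G (Ioo a b) := by
    refine monotoneOn_of_deriv_nonneg (convex_Ioo a b)
      (fun y hy => (hG' y hy).continuousAt.continuousWithinAt) ?_ ?_
    · rw [interior_Ioo]
      exact fun y hy => (hG' y hy).differentiableAt.differentiableWithinAt
    · rw [interior_Ioo]
      intro y hy
      rw [(hG' y hy).deriv]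
      have := mul_nonneg (sub_nonneg.2 (hQR y hy).le) (sq_nonneg (v y))
      linarith [hnn y hy]
  -- A monotone function with limit 0 at both ends is 0; then both terms of G' vanish, and R - Q > 0
  -- gives v = 0.
  have hzero : ∀ y ∈ Ioo a b, G y = 0 := by
    intro y hy
    refine le_antisymm (ge_of_tendsto hb ?_) (le_of_tendsto ha ?_)
    · filter_upwards [Ioo_mem_nhdsLT hy.2] with z hz
      exact hmono hy ⟨hy.1.trans hz.1, hz.2⟩ hz.1.le
    · filter_upwards [Ioo_mem_nhdsGT hy.1] with z hz
      exact hmono ⟨hz.1, hz.2.trans hy.2⟩ hy hz.2.le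
  intro y hy
  have h0 : HasDerivAt G 0 y := (hasDerivAt_const y (0 : ℝ)).congr_of_eventuallyEq <| by
    filter_upwards [Ioo_mem_nhds hy.1 hy.2] with z hz using hzero z hz
  have h1 := (hG' y hy).unique h0
  have h2 := sub_pos.2 (hQR y hy)
  have h3 : (R y - Q y) * v y ^ 2 ≤ 0 := by linarith [hnn y hy]
  have h4 := nonpos_of_mul_nonpos_right h3 h2
  exact pow_eq_zero_iff two_ne_zero |>.1 (le_antisymm h4 (sq_nonneg _))

/-- The boundary term in Picone's identity tends to zero at a common zero. -/
lemma tendsto_picone_term {v w ψ χ : ℝ → ℝ} {e v₁ ψ₁ : ℝ} (hv : HasDerivAt v v₁ e)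
    (hψ : HasDerivAt ψ ψ₁ e) (hψ₁ : ψ₁ ≠ 0) (hw : ContinuousAt w e) (hχ : ContinuousAt χ e)
    (hve : v e = 0) (hψe : ψ e = 0) :
    Tendsto (fun y => v y * w y - v y * χ y * (v y / ψ y)) (𝓝[≠] e) (𝓝 0) := by
  -- Near the common zero, v/ψ is the quotient of the two difference quotients.
  have hquot : Tendsto (fun y => v y / ψ y) (𝓝[≠] e) (𝓝 (v₁ / ψ₁)) := by
    refine (hv.tendsto_slope.div hψ.tendsto_slope hψ₁).congr' ?_
    filter_upwards [self_mem_nhdsWithin] with y hy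
    have : y - e ≠ 0 := sub_ne_zero.2 hy
    simp only [Pi.div_apply, slope_def_field, hve, hψe, sub_zero]
    exact div_div_div_cancel_right₀ this _ _
  have hv0 : Tendsto v (𝓝[≠] e) (𝓝 0) := by
    simpa [hve] using hv.continuousAt.tendsto.mono_left nhdsWithin_le_nhds
  have hw0 : Tendsto w (𝓝[≠] e) (𝓝 (w e)) := hw.tendsto.mono_left nhdsWithin_le_nhds
  have hχ0 : Tendsto χ (𝓝[≠] e) (𝓝 (χ e)) := hχ.tendsto.mono_left nhdsWithin_le_nhds
  simpa using (hv0.mul hw0).sub ((hv0.mul hχ0).mul hquot)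

/-! ### The profile functions -/

lemma conformalFactor_eq (y : ℝ) : conformalFactor y = 3 + 2 * Real.sin (angle y) ^ 2 := by
  rw [conformalFactor, phi1_sq, phi2_sq]; ring

lemma conformalFactor_pos (y : ℝ) : 0 < conformalFactor y := by
  rw [conformalFactor_eq]; positivity

lemma conformalFactor_le (y : ℝ) : conformalFactor y ≤ 5 := by
  rw [conformalFactor_eq]; linarith [Real.sin_sq_le_one (angle y)]

/-- The derivative of the angle function. -/
noncomputable def angleSpeed (y : ℝ) : ℝ := √(3 + Real.sin (angle y) ^ 2)

lemma angleSpeed_pos (y : ℝ) : 0 < angleSpeed y := Real.sqrt_pos.2 (by positivity)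

lemma angleSpeed_sq (y : ℝ) : angleSpeed y ^ 2 = 3 + Real.sin (angle y) ^ 2 :=
  Real.sq_sqrt (by positivity)

lemma hasDerivAt_cos_angle (y : ℝ) :
    HasDerivAt (fun z => Real.cos (angle z)) (-Real.sin (angle y) * angleSpeed y) y :=
  (Real.hasDerivAt_cos _).comp y (hasDerivAt_angle y)

/-- Since θ'² = 3 + sin² θ and θ'' = sin θ cos θ, this amounts to (cos θ)'' = -W cos θ. It yields
the equation of φ₀ and also the comparison system for index zero. -/
lemma hasDerivAt_sin_angle_mul_speed (y : ℝ) :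
    HasDerivAt (fun z => Real.sin (angle z) * angleSpeed z)
      (conformalFactor y * Real.cos (angle y)) y := by
  refine (((Real.hasDerivAt_sin _).comp y (hasDerivAt_angle y)).mul
    (hasDerivAt_deriv_angle y)).congr_deriv ?_
  have h := angleSpeed_sq y
  rw [angleSpeed] at h
  rw [conformalFactor_eq]
  simp only [Function.comp_apply]
  linear_combination Real.cos (angle y) * h

/-- The derivative of `φ₁`. -/
noncomputable def dphi1 (y : ℝ) : ℝ := 1 / √2 * (Real.cos (angle y) * angleSpeed y)

/-- The derivative of `φ₂`. -/
noncomputable def dphi2 (y : ℝ) : ℝ := 1 / √8 * (Real.sin (angle y) * Real.cos (angle y))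

/-- The derivative of `φ₀`. -/
noncomputable def dphi0 (y : ℝ) : ℝ := -√(5 / 8) * (Real.sin (angle y) * angleSpeed y)

lemma hasDerivAt_phi0 (y : ℝ) : HasDerivAt phi0 (dphi0 y) y :=
  ((hasDerivAt_cos_angle y).const_mul _).congr_deriv (by rw [dphi0]; ring)

lemma hasDerivAt_dphi0 (y : ℝ) : HasDerivAt dphi0 (-conformalFactor y * phi0 y) y :=
  ((hasDerivAt_sin_angle_mul_speed y).const_mul _).congr_deriv (by rw [phi0]; ring)

lemma hasDerivAt_phi1 (y : ℝ) : HasDerivAt phi1 (dphi1 y) y :=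
  ((Real.hasDerivAt_sin _).comp y (hasDerivAt_angle y)).const_mul _

lemma hasDerivAt_phi2 (y : ℝ) : HasDerivAt phi2 (dphi2 y) y :=
  ((hasDerivAt_deriv_angle y).const_mul (1 / √8)).congr_of_eventuallyEq
    (Filter.Eventually.of_forall phi2_eq)

lemma hasDerivAt_dphi1 (y : ℝ) : HasDerivAt dphi1 ((1 - conformalFactor y) * phi1 y) y := by
  refine (((hasDerivAt_cos_angle y).mul (hasDerivAt_deriv_angle y)).const_mul
    (1 / √2)).congr_deriv ?_
  have e := angleSpeed_sq y
  rw [conformalFactor_eq, phi1]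
  rw [angleSpeed] at *
  linear_combination (1 / √2 * Real.sin (angle y)) * (Real.sin_sq_add_cos_sq (angle y) - e)

lemma hasDerivAt_dphi2 (y : ℝ) : HasDerivAt dphi2 ((4 - conformalFactor y) * phi2 y) y := by
  refine ((((Real.hasDerivAt_sin _).comp y (hasDerivAt_angle y)).mul
    (hasDerivAt_cos_angle y)).const_mul (1 / √8)).congr_deriv ?_
  rw [conformalFactor_eq, phi2_eq, angleSpeed]
  simp only [Function.comp_apply]
  linear_combination (1 / √8 * √(3 + Real.sin (angle y) ^ 2)) *
    (Real.sin_sq_add_cos_sq (angle y))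

lemma phi2_pos (y : ℝ) : 0 < phi2 y := Real.sqrt_pos.2 (by positivity)

lemma strictMono_angle : StrictMono angle := fun x y hxy => by
  rw [← strictMono_yOfAngle.lt_iff_lt, yOfAngle_angle, yOfAngle_angle]; exact hxy

lemma angle_half_period : angle (period / 2) = Real.pi :=
  angle_eq_of (by rw [yOfAngle_pi, period]; ring)

lemma half_period_pos : 0 < period / 2 := by
  rw [← strictMono_angle.lt_iff_lt, angle_half_period, angle_zero]; exact Real.pi_pos

/-- The angle runs from 0 to π over half a period. This supplies the positivity of φ₁ and of sin θ ·
θ' that Picone's identity needs. -/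
lemma sin_angle_pos {y : ℝ} (hy : y ∈ Ioo 0 (period / 2)) : 0 < Real.sin (angle y) := by
  refine Real.sin_pos_of_pos_of_lt_pi ?_ ?_
  · rw [← angle_zero]; exact strictMono_angle hy.1
  · rw [← angle_half_period]; exact strictMono_angle hy.2

/-! ### The separated equation -/

/-- `f` solves `f'' = (m² - μ W) f`, where `W` is the conformal factor, with `f' = g`, it is
periodic, and it has the parity of `m`. -/
structure IsRadialMode (m : ℕ) (μ : ℝ) (f g : ℝ → ℝ) : Prop where
  deriv_fst : ∀ y, HasDerivAt f (g y) y
  deriv_snd : ∀ y, HasDerivAt g (((m : ℝ) ^ 2 - μ * conformalFactor y) * f y) y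
  parity : ∀ y, f (-y) = (-1) ^ m * f y
  periodic : ∀ y, f (y + period) = f y

namespace IsRadialMode

variable {m : ℕ} {μ : ℝ} {f g : ℝ → ℝ}

lemma deriv_parity (h : IsRadialMode m μ f g) (y : ℝ) : g (-y) = -((-1) ^ m * g y) := by
  have h1 : HasDerivAt (fun z => f (-z)) (g (-y) * -1) y :=
    (h.deriv_fst (-y)).comp y (hasDerivAt_neg y)
  have h2 : HasDerivAt (fun z => f (-z)) ((-1) ^ m * g y) y := by
    simp only [h.parity]; exact (h.deriv_fst y).const_mul _
  linarith [h1.unique h2]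

lemma deriv_periodic (h : IsRadialMode m μ f g) (y : ℝ) : g (y + period) = g y := by
  have h1 : HasDerivAt (fun z => f (z + period)) (g (y + period)) y := by
    simpa using (h.deriv_fst (y + period)).comp_add_const y period
  simp only [h.periodic] at h1
  exact h1.unique (h.deriv_fst y)

lemma eq_zero_of_initial (h : IsRadialMode m μ f g) {t : ℝ} (hf : f t = 0) (hg : g t = 0) :
    f = 0 := by
  funext y
  -- The coefficient m² - μW is bounded because 0 < W ≤ 5.
  refine linear_ode_unique (C := (m : ℝ) ^ 2 + |μ| * 5) (fun z => ?_) h.deriv_fst h.deriv_snd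
    hf hg y
  refine (abs_sub _ _).trans ?_
  rw [abs_mul, abs_of_pos (conformalFactor_pos z), abs_of_nonneg (sq_nonneg (m : ℝ))]
  gcongr
  exact conformalFactor_le z

/-- A solution that vanishes on an interval vanishes identically. -/
lemma eq_zero_of_Ioo (h : IsRadialMode m μ f g) {b : ℝ} (hb : 0 < b)
    (hz : ∀ y ∈ Ioo 0 b, f y = 0) : f = 0 := by
  have hy : b / 2 ∈ Ioo 0 b := ⟨by linarith, by linarith⟩
  refine h.eq_zero_of_initial (hz _ hy) ?_
  refine (h.deriv_fst (b / 2)).unique ((hasDerivAt_const _ (0 : ℝ)).congr_of_eventuallyEq ?_)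
  filter_upwards [Ioo_mem_nhds hy.1 hy.2] with z hz' using hz z hz'

lemma sub_const_mul (h : IsRadialMode m μ f g) {f' g' : ℝ → ℝ} (h' : IsRadialMode m μ f' g')
    (c : ℝ) : IsRadialMode m μ (fun y => f y - c * f' y) (fun y => g y - c * g' y) where
  deriv_fst y := (h.deriv_fst y).sub ((h'.deriv_fst y).const_mul c)
  deriv_snd y := ((h.deriv_snd y).sub ((h'.deriv_snd y).const_mul c)).congr_deriv (by ring)
  parity y := by rw [h.parity, h'.parity]; ring
  periodic y := by rw [h.periodic, h'.periodic]

/-- Solutions with the same index and parity are proportional. -/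
lemma exists_eq_mul (h : IsRadialMode m μ f g) {f' g' : ℝ → ℝ} (h' : IsRadialMode m μ f' g')
    (h0 : f' 0 ≠ 0 ∨ g' 0 ≠ 0) : ∃ c, ∀ y, f y = c * f' y := by
  suffices H : ∃ c, f 0 = c * f' 0 ∧ g 0 = c * g' 0 by
    obtain ⟨c, hc, hc'⟩ := H
    refine ⟨c, fun y => sub_eq_zero.1 ?_⟩
    exact congrFun ((h.sub_const_mul h' c).eq_zero_of_initial (t := 0) (by simp [hc])
      (by simp [hc'])) y
  have e1 := h.parity 0
  have e2 := h'.parity 0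
  have e3 := h.deriv_parity 0
  have e4 := h'.deriv_parity 0
  rw [neg_zero] at e1 e2 e3 e4
  -- At 0 the parity kills the derivative for even m and the value for odd m, so the initial data
  -- form a line and c is the ratio of the remaining entries.
  rcases neg_one_pow_eq_or ℝ m with hm | hm <;> rw [hm] at e1 e2 e3 e4
  · have z3 : g 0 = 0 := by linarith
    have z4 : g' 0 = 0 := by linarith
    have hne : f' 0 ≠ 0 := by tauto
    exact ⟨f 0 / f' 0, by field_simp, by simp [z3, z4]⟩
  · have z3 : f 0 = 0 := by linarith
    have z4 : f' 0 = 0 := by linarith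
    have hne : g' 0 ≠ 0 := by tauto
    exact ⟨g 0 / g' 0, by simp [z3, z4], by field_simp⟩

lemma continuous_fst (h : IsRadialMode m μ f g) : Continuous f :=
  continuous_iff_continuousAt.2 fun y => (h.deriv_fst y).continuousAt

lemma continuous_snd (h : IsRadialMode m μ f g) : Continuous g :=
  continuous_iff_continuousAt.2 fun y => (h.deriv_snd y).continuousAt

end IsRadialMode

lemma isRadialMode_phi0 : IsRadialMode 0 1 phi0 dphi0 where
  deriv_fst := hasDerivAt_phi0
  deriv_snd y := (hasDerivAt_dphi0 y).congr_deriv (by simp)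
  parity y := by simp [phi0_neg]
  periodic := phi0_add_period

lemma isRadialMode_phi1 : IsRadialMode 1 1 phi1 dphi1 where
  deriv_fst := hasDerivAt_phi1
  deriv_snd y := (hasDerivAt_dphi1 y).congr_deriv (by simp)
  parity y := by simp [phi1_neg]
  periodic := phi1_add_period

lemma isRadialMode_phi2 : IsRadialMode 2 1 phi2 dphi2 where
  deriv_fst := hasDerivAt_phi2
  deriv_snd y := (hasDerivAt_dphi2 y).congr_deriv (by norm_num)
  parity y := by simp [phi2_neg]
  periodic := phi2_add_period

namespace IsRadialMode

variable {m : ℕ} {μ : ℝ} {f g : ℝ → ℝ}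

/-- There are no modes of index at least two below the ground state `φ₂`. -/
lemma eq_zero_of_two_le (h : IsRadialMode m μ f g)
    (hlt : ∀ y, 4 - conformalFactor y < (m : ℝ) ^ 2 - μ * conformalFactor y) : f = 0 := by
  have h2 := isRadialMode_phi2
  set G : ℝ → ℝ := fun y => f y * g y - f y * dphi2 y * (f y / phi2 y) with hG
  have hcont : Continuous G := by
    have := h.continuous_fst
    have := h.continuous_snd
    have := h2.continuous_fst
    have := h2.continuous_snd
    have hne := fun y => (phi2_pos y).ne'
    fun_prop (disch := exact hne _)
  -- Either f or f' vanishes at 0 by parity, and φ₂' vanishes there because φ₂ is even; periodicity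
  -- carries this to the other endpoint.
  have hG0 : G 0 = 0 := by
    have e1 := h.parity 0
    have e3 := h.deriv_parity 0
    have e4 := h2.deriv_parity 0
    rw [neg_zero] at e1 e3 e4
    have z4 : dphi2 0 = 0 := by linarith
    rcases neg_one_pow_eq_or ℝ m with hm | hm <;> rw [hm] at e1 e3
    · have : g 0 = 0 := by linarith
      simp [hG, z4, this]
    · have : f 0 = 0 := by linarith
      simp [hG, z4, this]
  have hGp : G period = 0 := by
    have e1 := h.periodic 0
    have e2 := h.deriv_periodic 0
    have e3 := h2.periodic 0
    have e4 := h2.deriv_periodic 0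
    rw [zero_add] at e1 e2 e3 e4
    rw [← hG0]
    simp only [hG, e1, e2, e3, e4]
  refine h.eq_zero_of_Ioo (b := period) (by linarith [half_period_pos]) ?_
  refine picone_eq_zero (A := fun _ => 1) (w := g) (ψ := phi2) (χ := dphi2)
    (Q := fun y => -((m : ℝ) ^ 2 - μ * conformalFactor y)) (R := fun y => -(4 - conformalFactor y))
    (fun y _ => by simpa using h.deriv_fst y) (fun y _ => by simpa using h.deriv_snd y)
    (fun y _ => by simpa using hasDerivAt_phi2 y) (fun y _ => by simpa using hasDerivAt_dphi2 y)
    (fun y _ => phi2_pos y) (fun _ _ => zero_le_one) (fun y _ => neg_lt_neg (hlt y)) ?_ ?_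
  · have := hcont.continuousAt.tendsto (x := 0)
    rw [hG0] at this
    exact this.mono_left nhdsWithin_le_nhds
  · have := hcont.continuousAt.tendsto (x := period)
    rw [hGp] at this
    exact this.mono_left nhdsWithin_le_nhds

/-- There are no odd modes of index one below `φ₁`. -/
lemma eq_zero_of_one (h : IsRadialMode 1 μ f g) (hμ : μ < 1) : f = 0 := by
  have h1 := isRadialMode_phi1
  have e0 : f 0 = 0 := by
    have := h.parity 0
    rw [neg_zero] at this; linarith
  -- The points a/2 and -a/2 agree modulo the period, so oddness forces a zero.
  have eh : f (period / 2) = 0 := by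
    have e1 := h.parity (period / 2)
    have e2 := h.periodic (-(period / 2))
    rw [show -(period / 2) + period = period / 2 by ring] at e2
    linarith
  have p0 : phi1 0 = 0 := by simp [phi1, angle_zero]
  have ph : phi1 (period / 2) = 0 := by simp [phi1, angle_half_period]
  -- The endpoint zeros of φ₁ are simple, which makes the boundary terms of Picone's identity tend
  -- to 0.
  have d0 : dphi1 0 ≠ 0 := by
    have := (angleSpeed_pos 0).ne'
    simp [dphi1, angle_zero, this]
  have dh : dphi1 (period / 2) ≠ 0 := by
    have := (angleSpeed_pos (period / 2)).ne'
    simp [dphi1, angle_half_period, this]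
  refine h.eq_zero_of_Ioo half_period_pos ?_
  refine picone_eq_zero (A := fun _ => 1) (w := g) (ψ := phi1) (χ := dphi1)
    (Q := fun y => -(1 - μ * conformalFactor y)) (R := fun y => -(1 - conformalFactor y))
    (fun y _ => by simpa using h.deriv_fst y) (fun y _ => by simpa using h.deriv_snd y)
    (fun y _ => by simpa using hasDerivAt_phi1 y) (fun y _ => by simpa using hasDerivAt_dphi1 y)
    (fun y hy => mul_pos (by positivity) (sin_angle_pos hy)) (fun _ _ => zero_le_one)
    (fun y _ => by nlinarith [conformalFactor_pos y]) ?_ ?_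
  · exact (tendsto_picone_term (h.deriv_fst 0) (h1.deriv_fst 0) d0
      h.continuous_snd.continuousAt h1.continuous_snd.continuousAt e0 p0).mono_left
      (nhdsGT_le_nhdsNE _)
  · exact (tendsto_picone_term (h.deriv_fst _) (h1.deriv_fst _) dh
      h.continuous_snd.continuousAt h1.continuous_snd.continuousAt eh ph).mono_left
      (nhdsLT_le_nhdsNE _)

/-- There are no even modes of index zero between the constants and `φ₀`. -/
lemma eq_zero_of_zero (h : IsRadialMode 0 μ f g) (hμ : μ < 1) (hμ0 : μ ≠ 0) : f = 0 := by
  have e0 : g 0 = 0 := by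
    have := h.deriv_parity 0
    rw [neg_zero] at this; linarith
  have eh : g (period / 2) = 0 := by
    have e1 := h.deriv_parity (period / 2)
    have e2 := h.deriv_periodic (-(period / 2))
    rw [show -(period / 2) + period = period / 2 by ring] at e2
    linarith
  -- It is f', not f, that vanishes at the endpoints, so the comparison is made for derivatives.
  -- With v = f' and w = -μf the equation reads v' = W w, w' = -μ v, and (ψ, χ) solves the same
  -- system with μ replaced by 1.
  set ψ : ℝ → ℝ := fun z => Real.sin (angle z) * angleSpeed z with hψ
  set χ : ℝ → ℝ := fun z => Real.cos (angle z) with hχ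
  have p0 : ψ 0 = 0 := by simp [hψ, angle_zero]
  have ph : ψ (period / 2) = 0 := by simp [hψ, angle_half_period]
  have dψ : ∀ y, HasDerivAt ψ (conformalFactor y * χ y) y := hasDerivAt_sin_angle_mul_speed
  have dχ : ∀ y, HasDerivAt χ (-1 * ψ y) y := fun y =>
    (hasDerivAt_cos_angle y).congr_deriv (by simp [hψ])
  have d0 : conformalFactor 0 * χ 0 ≠ 0 := by
    simp [hχ, angle_zero, (conformalFactor_pos 0).ne']
  have dh : conformalFactor (period / 2) * χ (period / 2) ≠ 0 := by
    simp [hχ, angle_half_period, (conformalFactor_pos (period / 2)).ne']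
  have cχ : Continuous χ := continuous_iff_continuousAt.2 fun y => (dχ y).continuousAt
  have cw : Continuous fun y => -μ * f y := h.continuous_fst.const_mul _
  have hg : ∀ y ∈ Ioo 0 (period / 2), g y = 0 := by
    refine picone_eq_zero (A := conformalFactor) (w := fun y => -μ * f y) (ψ := ψ) (χ := χ)
      (Q := fun _ => μ) (R := fun _ => 1)
      (fun y _ => (h.deriv_snd y).congr_deriv (by simp; ring))
      (fun y _ => (h.deriv_fst y).const_mul _) (fun y _ => dψ y) (fun y _ => dχ y)
      (fun y hy => mul_pos (sin_angle_pos hy) (angleSpeed_pos y))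
      (fun y _ => (conformalFactor_pos y).le) (fun _ _ => hμ) ?_ ?_
    · exact (tendsto_picone_term (h.deriv_snd 0) (dψ 0) d0 cw.continuousAt cχ.continuousAt
        e0 p0).mono_left (nhdsGT_le_nhdsNE _)
    · exact (tendsto_picone_term (h.deriv_snd _) (dψ _) dh cw.continuousAt cχ.continuousAt
        eh ph).mono_left (nhdsLT_le_nhdsNE _)
  refine h.eq_zero_of_Ioo half_period_pos fun y hy => ?_
  -- Once f' vanishes on the interval, so does f'' = -μW f; here μ ≠ 0 is what rules out the
  -- constants.
  have h1 := (h.deriv_snd y).unique <| (hasDerivAt_const y (0 : ℝ)).congr_of_eventuallyEq <| by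
    filter_upwards [Ioo_mem_nhds hy.1 hy.2] with z hz' using hg z hz'
  have hW := (conformalFactor_pos y).ne'
  simpa [hμ0, hW] using h1

/-- Below the first eigenvalue all modes vanish. -/
lemma eq_zero_of_lt_one (h : IsRadialMode m μ f g) (hμ : μ < 1) (hμ0 : μ ≠ 0) : f = 0 := by
  match m, h with
  | 0, h => exact h.eq_zero_of_zero hμ hμ0
  | 1, h => exact h.eq_zero_of_one hμ
  | n + 2, h =>
    refine h.eq_zero_of_two_le fun y => ?_
    have hn : (0 : ℝ) ≤ n := n.cast_nonneg
    push_cast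
    nlinarith [conformalFactor_pos y]

/-- Modes of index at least three do not contribute to the eigenvalue `1`. -/
lemma eq_zero_of_three_le (h : IsRadialMode m 1 f g) (hm : 3 ≤ m) : f = 0 := by
  refine h.eq_zero_of_two_le fun y => ?_
  have hn : (3 : ℝ) ≤ m := by exact_mod_cast hm
  nlinarith

lemma exists_eq_mul_phi0 (h : IsRadialMode 0 1 f g) : ∃ c, ∀ y, f y = c * phi0 y :=
  h.exists_eq_mul isRadialMode_phi0 (.inl (by simp [phi0, angle_zero]))

lemma exists_eq_mul_phi1 (h : IsRadialMode 1 1 f g) : ∃ c, ∀ y, f y = c * phi1 y :=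
  h.exists_eq_mul isRadialMode_phi1
    (.inr (by simp [dphi1, angle_zero, (angleSpeed_pos 0).ne']))

lemma exists_eq_mul_phi2 (h : IsRadialMode 2 1 f g) : ∃ c, ∀ y, f y = c * phi2 y :=
  h.exists_eq_mul isRadialMode_phi2 (.inl (phi2_pos 0).ne')

end IsRadialMode

end ExtremalKlein
namespace ExtremalKlein

open Set Filter Topology

/-! ### Partial derivatives in the plane -/

lemma contDiff_partialDeriv {U : Plane → ℝ} (hU : ContDiff ℝ (⊤ : ℕ∞) U) (i : Fin 2) :
    ContDiff ℝ (⊤ : ℕ∞) (partialDeriv i U) :=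
  (hU.fderiv_right (m := ((⊤ : ℕ∞) : WithTop ℕ∞)) (by simp)).clm_apply contDiff_const

lemma hasDerivAt_slice_fst {U : Plane → ℝ} (hU : ContDiff ℝ (⊤ : ℕ∞) U) (x y : ℝ) :
    HasDerivAt (fun t => U ![t, y]) (partialDeriv 0 U ![x, y]) x := by
  have h : HasDerivAt (fun t : ℝ => (![t, y] : Plane)) (Pi.single 0 1) x := by
    rw [hasDerivAt_pi]
    intro i
    fin_cases i
    · simpa using hasDerivAt_id' x
    · simpa using hasDerivAt_const x y
  exact ((hU.differentiable (by simp)) ![x, y]).hasFDerivAt.comp_hasDerivAt x h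

lemma hasDerivAt_slice_snd {U : Plane → ℝ} (hU : ContDiff ℝ (⊤ : ℕ∞) U) (x y : ℝ) :
    HasDerivAt (fun t => U ![x, t]) (partialDeriv 1 U ![x, y]) y := by
  have h : HasDerivAt (fun t : ℝ => (![x, t] : Plane)) (Pi.single 1 1) y := by
    rw [hasDerivAt_pi]
    intro i
    fin_cases i
    · simpa using hasDerivAt_const y x
    · simpa using hasDerivAt_id' y
  exact ((hU.differentiable (by simp)) ![x, y]).hasFDerivAt.comp_hasDerivAt y h

lemma continuous_pair {U : Plane → ℝ} (hU : Continuous U) :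
    Continuous fun p : ℝ × ℝ => U ![p.1, p.2] := by
  refine hU.comp (continuous_pi fun i => ?_)
  fin_cases i
  · exact continuous_fst
  · exact continuous_snd

lemma continuous_slice_fst {U : Plane → ℝ} (hU : Continuous U) (y : ℝ) :
    Continuous fun x => U ![x, y] :=
  (continuous_pair hU).comp (continuous_id.prodMk continuous_const)

/-- Differentiation under the integral sign in the second variable. -/
lemma hasDerivAt_integral_slice {U : Plane → ℝ} (hU : ContDiff ℝ (⊤ : ℕ∞) U) {g : ℝ → ℝ}
    (hg : Continuous g) (a b y : ℝ) :
    HasDerivAt (fun t => ∫ x in a..b, U ![x, t] * g x)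
      (∫ x in a..b, partialDeriv 1 U ![x, y] * g x) y := by
  have hc := (contDiff_partialDeriv hU 1).continuous
  have hcont : Continuous fun p : ℝ × ℝ => partialDeriv 1 U ![p.1, p.2] * g p.1 :=
    (continuous_pair hc).mul (hg.comp continuous_fst)
  -- The dominating function is a constant: a bound for the y-derivative of the integrand on a
  -- compact rectangle.
  obtain ⟨C, hC⟩ := (isCompact_uIcc (a := a) (b := b)).prod (isCompact_Icc (a := y - 1) (b := y + 1))
    |>.exists_bound_of_continuousOn hcont.continuousOn
  refine (intervalIntegral.hasDerivAt_integral_of_dominated_loc_of_deriv_le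
    (F := fun t x => U ![x, t] * g x) (F' := fun t x => partialDeriv 1 U ![x, t] * g x)
    (bound := fun _ => C) (s := Icc (y - 1) (y + 1)) (Icc_mem_nhds (by linarith) (by linarith))
    (Eventually.of_forall fun t => ?_) ?_ ?_ ?_ (by simp) ?_).2
  · exact ((continuous_slice_fst hU.continuous t).mul hg).aestronglyMeasurable
  · exact ((continuous_slice_fst hU.continuous y).mul hg).intervalIntegrable _ _
  · exact ((continuous_slice_fst hc y).mul hg).aestronglyMeasurable
  · exact Eventually.of_forall fun x hx t ht => hC (x, t) ⟨uIoc_subset_uIcc hx, ht⟩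
  · exact Eventually.of_forall fun x _ t _ => (hasDerivAt_slice_snd hU x t).mul_const _

/-! ### Separation of variables -/

/-- `U` solves `∂ₓ² U + ∂ᵧ² U = -μ W U` in the plane and is invariant under the generators of
the group of motions. -/
structure IsPlaneEigenfunction (μ : ℝ) (U : Plane → ℝ) : Prop where
  contDiff : ContDiff ℝ (⊤ : ℕ∞) U
  equation : ∀ q, partialDeriv 0 (partialDeriv 0 U) q + partialDeriv 1 (partialDeriv 1 U) q =
    -μ * conformalFactor (q 1) * U q
  glide_eq : ∀ q, U (glide q) = U q
  shift_eq : ∀ q, U (shift q) = U q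

/-- `g` solves `g'' = -m² g`, with `g' = g₁`, and `x ↦ x + π` multiplies it by `(-1)^m`. -/
structure IsAngularMode (m : ℕ) (g g₁ : ℝ → ℝ) : Prop where
  deriv_fst : ∀ x, HasDerivAt g (g₁ x) x
  deriv_snd : ∀ x, HasDerivAt g₁ (-(m : ℝ) ^ 2 * g x) x
  antiperiodic : ∀ x, g (x + Real.pi) = (-1) ^ m * g x

lemma isAngularMode_cos (m : ℕ) :
    IsAngularMode m (fun x => Real.cos (m * x)) (fun x => -(m * Real.sin (m * x))) where
  deriv_fst x := (((hasDerivAt_id x).const_mul (m : ℝ)).cos).congr_deriv (by simp; ring)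
  deriv_snd x := ((((hasDerivAt_id x).const_mul (m : ℝ)).sin.const_mul (m : ℝ)).neg).congr_deriv
    (by simp; ring)
  antiperiodic x := by rw [mul_add, Real.cos_add_nat_mul_pi]

lemma isAngularMode_sin (m : ℕ) :
    IsAngularMode m (fun x => Real.sin (m * x)) (fun x => m * Real.cos (m * x)) where
  deriv_fst x := (((hasDerivAt_id x).const_mul (m : ℝ)).sin).congr_deriv (by simp; ring)
  deriv_snd x := (((hasDerivAt_id x).const_mul (m : ℝ)).cos.const_mul (m : ℝ)).congr_deriv
    (by simp; ring)
  antiperiodic x := by rw [mul_add, Real.sin_add_nat_mul_pi]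

namespace IsAngularMode

variable {m : ℕ} {g g₁ : ℝ → ℝ}

lemma continuous_fst (h : IsAngularMode m g g₁) : Continuous g :=
  continuous_iff_continuousAt.2 fun x => (h.deriv_fst x).continuousAt

lemma continuous_snd (h : IsAngularMode m g g₁) : Continuous g₁ :=
  continuous_iff_continuousAt.2 fun x => (h.deriv_snd x).continuousAt

lemma periodic (h : IsAngularMode m g g₁) (x : ℝ) : g (x + 2 * Real.pi) = g x := by
  rw [two_mul, ← add_assoc, h.antiperiodic, h.antiperiodic, ← mul_assoc, ← mul_pow]
  simp

lemma deriv_periodic (h : IsAngularMode m g g₁) (x : ℝ) : g₁ (x + 2 * Real.pi) = g₁ x := by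
  have h1 : HasDerivAt (fun z => g (z + 2 * Real.pi)) (g₁ (x + 2 * Real.pi)) x := by
    simpa using (h.deriv_fst (x + 2 * Real.pi)).comp_add_const x (2 * Real.pi)
  simp only [h.periodic] at h1
  exact h1.unique (h.deriv_fst x)

end IsAngularMode

namespace IsPlaneEigenfunction

variable {μ : ℝ} {U : Plane → ℝ}

lemma add_pi (h : IsPlaneEigenfunction μ U) (x y : ℝ) : U ![x + Real.pi, y] = U ![x, -y] := by
  simpa [glide] using h.glide_eq ![x, -y]

lemma periodic_snd (h : IsPlaneEigenfunction μ U) (x y : ℝ) :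
    U ![x, y + period] = U ![x, y] := by
  simpa [shift] using h.shift_eq ![x, y]

/-- Two glide reflections restore y and translate x by 2π. -/
lemma periodic_fst (h : IsPlaneEigenfunction μ U) (x y : ℝ) :
    U ![x + 2 * Real.pi, y] = U ![x, y] := by
  rw [two_mul, ← add_assoc, h.add_pi, h.add_pi, neg_neg]

lemma deriv_periodic_fst (h : IsPlaneEigenfunction μ U) (x y : ℝ) :
    partialDeriv 0 U ![x + 2 * Real.pi, y] = partialDeriv 0 U ![x, y] := by
  have h1 : HasDerivAt (fun z => U ![z + 2 * Real.pi, y])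
      (partialDeriv 0 U ![x + 2 * Real.pi, y]) x := by
    simpa using (hasDerivAt_slice_fst h.contDiff (x + 2 * Real.pi) y).comp_add_const x
      (2 * Real.pi)
  simp only [h.periodic_fst] at h1
  exact h1.unique (hasDerivAt_slice_fst h.contDiff x y)

/-- Two integrations by parts move the x-derivatives onto g; the boundary terms cancel because U and
g, with their first derivatives, have period 2π. -/
lemma integral_partialDeriv_fst (h : IsPlaneEigenfunction μ U) {m : ℕ} {g g₁ : ℝ → ℝ}
    (hg : IsAngularMode m g g₁) (y : ℝ) :
    ∫ x in (0 : ℝ)..(2 * Real.pi), g x * partialDeriv 0 (partialDeriv 0 U) ![x, y] =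
      -(m : ℝ) ^ 2 * ∫ x in (0 : ℝ)..(2 * Real.pi), U ![x, y] * g x := by
  have hU' := contDiff_partialDeriv h.contDiff 0
  have hU'' := contDiff_partialDeriv hU' 0
  rw [intervalIntegral.integral_mul_deriv_eq_deriv_mul (fun x _ => hg.deriv_fst x)
    (fun x _ => hasDerivAt_slice_fst hU' x y) (hg.continuous_snd.intervalIntegrable _ _)
    ((continuous_slice_fst hU''.continuous y).intervalIntegrable _ _),
    intervalIntegral.integral_mul_deriv_eq_deriv_mul (fun x _ => hg.deriv_snd x)
    (fun x _ => hasDerivAt_slice_fst h.contDiff x y)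
    ((hg.continuous_fst.const_mul _).intervalIntegrable _ _)
    ((continuous_slice_fst hU'.continuous y).intervalIntegrable _ _)]
  have e1 := hg.periodic 0
  have e2 := hg.deriv_periodic 0
  have e3 := h.periodic_fst 0 y
  have e4 := h.deriv_periodic_fst 0 y
  rw [zero_add] at e1 e2 e3 e4
  rw [e1, e2, e3, e4, sub_self, sub_self, zero_sub, zero_sub, neg_neg,
    ← intervalIntegral.integral_const_mul]
  exact intervalIntegral.integral_congr fun x _ => by ring

/-- The Fourier coefficients in `x` of an eigenfunction solve the separated equation. -/
lemma isRadialMode (h : IsPlaneEigenfunction μ U) {m : ℕ} {g g₁ : ℝ → ℝ}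
    (hg : IsAngularMode m g g₁) :
    IsRadialMode m μ (fun y => ∫ x in (0 : ℝ)..(2 * Real.pi), U ![x, y] * g x)
      (fun y => ∫ x in (0 : ℝ)..(2 * Real.pi), partialDeriv 1 U ![x, y] * g x) where
  deriv_fst y := hasDerivAt_integral_slice h.contDiff hg.continuous_fst _ _ y
  deriv_snd y := by
    have hU' := contDiff_partialDeriv h.contDiff 1
    refine (hasDerivAt_integral_slice hU' hg.continuous_fst _ _ y).congr_deriv ?_
    -- The equation trades the two y-derivatives for two x-derivatives, which integration by parts
    -- turns into the factor -m².
    have e : ∀ x, partialDeriv 1 (partialDeriv 1 U) ![x, y] * g x =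
        -μ * conformalFactor y * (U ![x, y] * g x) -
          g x * partialDeriv 0 (partialDeriv 0 U) ![x, y] := by
      intro x
      have := h.equation ![x, y]
      simp only [Matrix.cons_val_one, Matrix.cons_val_fin_one] at this
      linear_combination g x * this
    have c1 : Continuous fun x => U ![x, y] * g x :=
      (continuous_slice_fst h.contDiff.continuous y).mul hg.continuous_fst
    have c2 : Continuous fun x => g x * partialDeriv 0 (partialDeriv 0 U) ![x, y] :=
      hg.continuous_fst.mul (continuous_slice_fst (contDiff_partialDeriv
        (contDiff_partialDeriv h.contDiff 0) 0).continuous y)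
    simp only [e]
    rw [intervalIntegral.integral_sub ((c1.const_mul _).intervalIntegrable _ _)
      (c2.intervalIntegrable _ _), intervalIntegral.integral_const_mul,
      h.integral_partialDeriv_fst hg]
    ring
  parity y := by
    have hper : Function.Periodic (fun x => U ![x, y] * g x) (2 * Real.pi) := fun x => by
      simp only [h.periodic_fst, hg.periodic]
    -- The glide reflection turns y ↦ -y into x ↦ x + π, at the cost of (-1)^m from g; integrals
    -- over a full period do not see the translation.
    have e : ∀ x, U ![x, -y] * g x = (-1) ^ m * (U ![x + Real.pi, y] * g (x + Real.pi)) := by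
      intro x
      have h1 : ((-1 : ℝ) ^ m) * (-1) ^ m = 1 := by rw [← mul_pow]; simp
      rw [h.add_pi, hg.antiperiodic]
      linear_combination -(U ![x, -y] * g x) * h1
    simp only [e]
    rw [intervalIntegral.integral_const_mul,
      intervalIntegral.integral_comp_add_right (fun x => U ![x, y] * g x) Real.pi]
    have := hper.intervalIntegral_add_eq Real.pi 0
    rw [zero_add] at this
    rw [zero_add, add_comm (2 * Real.pi), this]
  periodic y := by simp only [h.periodic_snd]

end IsPlaneEigenfunction

/-! ### Reconstruction from finitely many Fourier coefficients -/

/-- A continuous periodic function whose Fourier coefficients of index above two vanish is a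
trigonometric polynomial of degree two. -/
lemma eq_trig_poly_of_coeff_eq_zero {f : ℝ → ℝ} (hf : Continuous f)
    (hper : ∀ x, f (x + 2 * Real.pi) = f x)
    (hcos : ∀ m : ℕ, 3 ≤ m → ∫ x in (0 : ℝ)..(2 * Real.pi), f x * Real.cos (m * x) = 0)
    (hsin : ∀ m : ℕ, 3 ≤ m → ∫ x in (0 : ℝ)..(2 * Real.pi), f x * Real.sin (m * x) = 0)
    (x : ℝ) :
    f x = 1 / (2 * Real.pi) * ((∫ t in (0 : ℝ)..(2 * Real.pi), f t * Real.cos ((0 : ℕ) * t)) +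
      2 * ((∫ t in (0 : ℝ)..(2 * Real.pi), f t * Real.cos ((1 : ℕ) * t)) * Real.cos ((1 : ℕ) * x) +
        (∫ t in (0 : ℝ)..(2 * Real.pi), f t * Real.sin ((1 : ℕ) * t)) * Real.sin ((1 : ℕ) * x) +
        (∫ t in (0 : ℝ)..(2 * Real.pi), f t * Real.cos ((2 : ℕ) * t)) * Real.cos ((2 : ℕ) * x) +
        (∫ t in (0 : ℝ)..(2 * Real.pi), f t * Real.sin ((2 : ℕ) * t)) * Real.sin ((2 : ℕ) * x))) := by
  set C : ℕ → ℝ := fun m => ∫ t in (0 : ℝ)..(2 * Real.pi), f t * Real.cos (m * t) with hC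
  set S : ℕ → ℝ := fun m => ∫ t in (0 : ℝ)..(2 * Real.pi), f t * Real.sin (m * t) with hS
  have : Fact (0 < 2 * Real.pi) := ⟨Real.two_pi_pos⟩
  have hperC : Function.Periodic (fun x => (f x : ℂ)) (2 * Real.pi) := fun x => by
    simp only [hper]
  let F : C(AddCircle (2 * Real.pi), ℂ) :=
    ⟨hperC.lift, continuous_coinduced_dom.2 (Complex.continuous_ofReal.comp hf)⟩
  have hF : ∀ t : ℝ, F (t : AddCircle (2 * Real.pi)) = f t := fun t => hperC.lift_coe t
  have hexp : ∀ (n : ℤ) (t : ℝ), fourier n (t : AddCircle (2 * Real.pi)) =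
      (Real.cos (n * t) : ℂ) + (Real.sin (n * t) : ℂ) * Complex.I := by
    intro n t
    have hpi : (Real.pi : ℂ) ≠ 0 := Complex.ofReal_ne_zero.2 Real.pi_ne_zero
    rw [fourier_coe_apply, Complex.ofReal_cos, Complex.ofReal_sin, ← Complex.exp_mul_I]
    congr 1
    push_cast
    field_simp
  have hcoeff : ∀ n : ℤ, fourierCoeff F n = (1 / (2 * Real.pi) : ℝ) *
      (((∫ t in (0 : ℝ)..(2 * Real.pi), f t * Real.cos (n * t) : ℝ) : ℂ) -
        ((∫ t in (0 : ℝ)..(2 * Real.pi), f t * Real.sin (n * t) : ℝ) : ℂ) * Complex.I) := by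
    intro n
    have c1 : Continuous fun t : ℝ => ((f t * Real.cos (n * t) : ℝ) : ℂ) := by fun_prop
    have c2 : Continuous fun t : ℝ => ((f t * Real.sin (n * t) : ℝ) : ℂ) * Complex.I := by
      fun_prop
    rw [fourierCoeff_eq_intervalIntegral _ n 0, zero_add, Complex.real_smul,
      ← intervalIntegral.integral_ofReal, ← intervalIntegral.integral_ofReal,
      ← intervalIntegral.integral_mul_const, ← intervalIntegral.integral_sub
        (c1.intervalIntegrable _ _) (c2.intervalIntegrable _ _)]
    congr 1
    refine intervalIntegral.integral_congr fun t _ => ?_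
    simp only [hexp, hF, smul_eq_mul]
    push_cast
    rw [neg_mul, Complex.cos_neg, Complex.sin_neg]
    ring
  -- As f is real, the coefficients at k and -k are conjugate, so the two terms will combine into
  -- real cosines and sines with a factor 2.
  have hnat : ∀ k : ℕ, fourierCoeff F k = (1 / (2 * Real.pi) : ℝ) * (C k - S k * Complex.I) :=
    fun k => by rw [hcoeff]; simp [hC, hS]
  have hneg : ∀ k : ℕ, fourierCoeff F (-k) = (1 / (2 * Real.pi) : ℝ) * (C k + S k * Complex.I) :=
    fun k => by rw [hcoeff]; simp [hC, hS]
  have hzero : ∀ n ∉ Finset.Icc (-2 : ℤ) 2, fourierCoeff F n = 0 := by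
    intro n hn
    rw [Finset.mem_Icc, not_and_or, not_le, not_le] at hn
    have h3 : 3 ≤ n.natAbs := by omega
    rcases Int.natAbs_eq n with h | h <;> rw [h]
    · rw [hnat]; simp only [hC, hS, hcos _ h3, hsin _ h3]; simp
    · rw [hneg]; simp only [hC, hS, hcos _ h3, hsin _ h3]; simp
  -- Finitely supported coefficients are summable, so the Fourier series converges pointwise to F,
  -- and its sum is the finite one.
  have hsum := has_pointwise_sum_fourier_series_of_summable
    (summable_of_ne_finset_zero hzero) (x : AddCircle (2 * Real.pi))
  have hfin := hsum.unique (hasSum_sum_of_ne_finset_zero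
    (s := Finset.Icc (-2 : ℤ) 2) fun n hn => by rw [hzero n hn, zero_smul])
  have hIcc : Finset.Icc (-2 : ℤ) 2 =
      {-((2 : ℕ) : ℤ), -((1 : ℕ) : ℤ), ((0 : ℕ) : ℤ), ((1 : ℕ) : ℤ), ((2 : ℕ) : ℤ)} := by
    decide
  have hS0 : S 0 = 0 := by simp [hS]
  rw [hF, hIcc, Finset.sum_insert (by decide), Finset.sum_insert (by decide),
    Finset.sum_insert (by decide), Finset.sum_insert (by decide), Finset.sum_singleton,
    hneg, hneg, hnat, hnat, hnat] at hfin
  simp only [hexp, smul_eq_mul, hS0] at hfin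
  change f x = 1 / (2 * Real.pi) * (C 0 + 2 * (C 1 * Real.cos ((1 : ℕ) * x) +
    S 1 * Real.sin ((1 : ℕ) * x) + C 2 * Real.cos ((2 : ℕ) * x) + S 2 * Real.sin ((2 : ℕ) * x)))
  rw [← Complex.ofReal_inj, hfin]
  push_cast
  simp only [neg_mul, Complex.cos_neg, Complex.sin_neg, zero_mul, Complex.cos_zero,
    Complex.sin_zero]
  linear_combination (-(1 / (2 * (Real.pi : ℂ))) * 2 * ((S 1 : ℂ) * Complex.sin (1 * x) +
    (S 2 : ℂ) * Complex.sin (2 * x))) * Complex.I_sq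

end ExtremalKlein
namespace ExtremalKlein

open Set Filter Topology

/-! ### The Laplacian in isothermal coordinates -/

lemma sqrt_det_metric (q : Plane) : √(metric q).det = conformalFactor (q 1) := by
  rw [metric, Matrix.det_diagonal, Fin.prod_univ_two, Real.sqrt_mul_self (conformalFactor_pos _).le]

lemma metric_inv (q : Plane) :
    (metric q)⁻¹ = Matrix.diagonal fun _ => (conformalFactor (q 1))⁻¹ := by
  refine Matrix.inv_eq_left_inv ?_
  rw [metric, Matrix.diagonal_mul_diagonal]
  simp [(conformalFactor_pos _).ne']

/-- In dimension two √det g = W cancels the factor 1/W of the inverse metric, so the divergence form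
reduces to the flat Laplacian. -/
lemma laplaceBeltrami_metric (U : Plane → ℝ) (q : Plane) :
    laplaceBeltrami metric U q = -(1 / conformalFactor (q 1)) *
      (partialDeriv 0 (partialDeriv 0 U) q + partialDeriv 1 (partialDeriv 1 U) q) := by
  have h : ∀ i, (fun r => √(metric r).det * ∑ j, (metric r)⁻¹ i j * partialDeriv j U r) =
      partialDeriv i U := by
    intro i
    funext r
    have hne := (conformalFactor_pos (r 1)).ne'
    rw [sqrt_det_metric, metric_inv]
    simp [Matrix.diagonal_apply, hne]
  rw [laplaceBeltrami, Fin.sum_univ_two, h, h, sqrt_det_metric]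

lemma laplaceBeltrami_metric_eq_iff (U : Plane → ℝ) (q : Plane) (μ : ℝ) :
    laplaceBeltrami metric U q = μ * U q ↔
      partialDeriv 0 (partialDeriv 0 U) q + partialDeriv 1 (partialDeriv 1 U) q =
        -μ * conformalFactor (q 1) * U q := by
  have hne := (conformalFactor_pos (q 1)).ne'
  rw [laplaceBeltrami_metric]
  field_simp
  constructor <;> intro h <;> linarith

lemma proj_eq_of_mem {γ : Equiv.Perm Plane} (hγ : γ ∈ deckGroup) (q : Plane) :
    proj (γ q) = proj q :=
  Quotient.sound (s := MulAction.orbitRel deckGroup Plane) ⟨⟨γ, hγ⟩, rfl⟩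

lemma proj_surjective : Function.Surjective proj :=
  Quotient.mk_surjective (s := MulAction.orbitRel deckGroup Plane)

lemma InEigenspace.isPlaneEigenfunction {μ : ℝ} {u : KleinBottle → ℝ} (h : InEigenspace μ u) :
    IsPlaneEigenfunction μ (u ∘ proj) where
  contDiff := h.1
  equation q := (laplaceBeltrami_metric_eq_iff _ q μ).1 (h.2 q)
  glide_eq q := congrArg u (proj_eq_of_mem (Subgroup.subset_closure (by simp)) q)
  shift_eq q := congrArg u (proj_eq_of_mem (Subgroup.subset_closure (by simp)) q)

lemma partialDeriv_add {U V : Plane → ℝ} (hU : ContDiff ℝ (⊤ : ℕ∞) U)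
    (hV : ContDiff ℝ (⊤ : ℕ∞) V) (i : Fin 2) :
    partialDeriv i (U + V) = partialDeriv i U + partialDeriv i V := by
  funext q
  simp [partialDeriv, fderiv_add (hU.differentiable (by simp) q) (hV.differentiable (by simp) q)]

lemma partialDeriv_const_smul {U : Plane → ℝ} (hU : ContDiff ℝ (⊤ : ℕ∞) U) (c : ℝ) (i : Fin 2) :
    partialDeriv i (c • U) = c • partialDeriv i U := by
  funext q
  simp [partialDeriv, fderiv_const_smul (hU.differentiable (by simp) q)]

/-- The eigenspace of the Laplacian as a subspace. -/
noncomputable def eigenspace (μ : ℝ) : Submodule ℝ (KleinBottle → ℝ) where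
  carrier := {u | InEigenspace μ u}
  add_mem' := by
    rintro u v ⟨hu, hu'⟩ ⟨hv, hv'⟩
    have e : (u + v) ∘ proj = u ∘ proj + v ∘ proj := rfl
    refine ⟨e ▸ hu.add hv, fun q => ?_⟩
    have h1 := hu' q
    have h2 := hv' q
    rw [laplaceBeltrami_metric] at h1 h2
    rw [e, laplaceBeltrami_metric]
    simp only [partialDeriv_add, hu, hv, contDiff_partialDeriv, Pi.add_apply]
    linear_combination h1 + h2
  zero_mem' := by
    have e : (0 : KleinBottle → ℝ) ∘ proj = fun _ => 0 := rfl
    refine ⟨e ▸ contDiff_const, fun q => ?_⟩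
    have h0 : ∀ i, partialDeriv i (fun _ => 0) = fun _ => 0 := fun i => by
      funext r; simp [partialDeriv]
    rw [e, laplaceBeltrami_metric]
    simp [h0]
  smul_mem' := by
    rintro c u ⟨hu, hu'⟩
    have e : (c • u) ∘ proj = c • (u ∘ proj) := rfl
    refine ⟨e ▸ contDiff_const.smul hu, fun q => ?_⟩
    have h1 := hu' q
    rw [laplaceBeltrami_metric] at h1
    rw [e, laplaceBeltrami_metric]
    simp only [partialDeriv_const_smul, hu, contDiff_partialDeriv, Pi.smul_apply, smul_eq_mul]
    linear_combination c * h1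

/-! ### The five functions are eigenfunctions -/

/-- Bootstrap: θ' = √(3 + sin² θ) is a smooth function of θ, as the radicand is positive, so each
order of differentiability gives the next. -/
lemma contDiff_angle : ContDiff ℝ (⊤ : ℕ∞) angle := by
  rw [contDiff_infty]
  intro n
  induction n with
  | zero => exact contDiff_zero.2 continuous_angle
  | succ n ih =>
    push_cast
    refine contDiff_succ_iff_deriv.2
      ⟨fun y => (hasDerivAt_angle y).differentiableAt, by simp, ?_⟩
    rw [show deriv angle = fun y => √(3 + Real.sin (angle y) ^ 2) from
      funext fun y => (hasDerivAt_angle y).deriv]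
    exact (contDiff_const.add ((Real.contDiff_sin.comp ih).pow 2)).sqrt fun y =>
      (by positivity : 0 < 3 + Real.sin (angle y) ^ 2).ne'

lemma contDiff_phi0 : ContDiff ℝ (⊤ : ℕ∞) phi0 :=
  contDiff_const.mul (Real.contDiff_cos.comp contDiff_angle)

lemma contDiff_phi1 : ContDiff ℝ (⊤ : ℕ∞) phi1 :=
  contDiff_const.mul (Real.contDiff_sin.comp contDiff_angle)

lemma contDiff_phi2 : ContDiff ℝ (⊤ : ℕ∞) phi2 :=
  ((contDiff_const.add ((Real.contDiff_sin.comp contDiff_angle).pow 2)).div_const 8).sqrt fun y =>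
    (by positivity : 0 < (3 + Real.sin (angle y) ^ 2) / 8).ne'

lemma hasFDerivAt_mul_separated {F F' G G' : ℝ → ℝ} (hF : ∀ y, HasDerivAt F (F' y) y)
    (hG : ∀ x, HasDerivAt G (G' x) x) (q : Plane) :
    HasFDerivAt (fun q : Plane => F (q 1) * G (q 0))
      (F (q 1) • G' (q 0) • ContinuousLinearMap.proj (R := ℝ) (φ := fun _ : Fin 2 => ℝ) 0 +
        G (q 0) • F' (q 1) • ContinuousLinearMap.proj (R := ℝ) (φ := fun _ : Fin 2 => ℝ) 1) q :=
  ((hF (q 1)).comp_hasFDerivAt q (hasFDerivAt_apply 1 q)).mul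
    ((hG (q 0)).comp_hasFDerivAt q (hasFDerivAt_apply 0 q))

lemma partialDeriv_zero_separated {F F' G G' : ℝ → ℝ} (hF : ∀ y, HasDerivAt F (F' y) y)
    (hG : ∀ x, HasDerivAt G (G' x) x) :
    partialDeriv 0 (fun q : Plane => F (q 1) * G (q 0)) = fun q => F (q 1) * G' (q 0) := by
  funext q
  rw [partialDeriv, (hasFDerivAt_mul_separated hF hG q).fderiv]
  simp

lemma partialDeriv_one_separated {F F' G G' : ℝ → ℝ} (hF : ∀ y, HasDerivAt F (F' y) y)
    (hG : ∀ x, HasDerivAt G (G' x) x) :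
    partialDeriv 1 (fun q : Plane => F (q 1) * G (q 0)) = fun q => F' (q 1) * G (q 0) := by
  funext q
  rw [partialDeriv, (hasFDerivAt_mul_separated hF hG q).fderiv]
  simp [mul_comm]

/-- A partial converse to `IsPlaneEigenfunction.isRadialMode`: in the flat Laplacian of a product
the terms m² and -m² cancel, leaving -μW. -/
lemma inEigenspace_of_separated {m : ℕ} {F F' G G' : ℝ → ℝ} {u : KleinBottle → ℝ} {μ : ℝ}
    (hu : u ∘ proj = fun q => F (q 1) * G (q 0)) (hF : IsRadialMode m μ F F')
    (hG : IsAngularMode m G G') (hFs : ContDiff ℝ (⊤ : ℕ∞) F) (hGs : ContDiff ℝ (⊤ : ℕ∞) G) :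
    InEigenspace μ u := by
  have hsmooth : ContDiff ℝ (⊤ : ℕ∞) fun q : Plane => F (q 1) * G (q 0) :=
    (hFs.comp (contDiff_apply ℝ ℝ 1)).mul (hGs.comp (contDiff_apply ℝ ℝ 0))
  refine ⟨hu ▸ hsmooth, fun q => (laplaceBeltrami_metric_eq_iff _ q μ).2 ?_⟩
  rw [hu, partialDeriv_zero_separated hF.deriv_fst hG.deriv_fst,
    partialDeriv_zero_separated hF.deriv_fst hG.deriv_snd,
    partialDeriv_one_separated hF.deriv_fst hG.deriv_fst,
    partialDeriv_one_separated hF.deriv_snd hG.deriv_fst]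
  ring

lemma span_modes_le :
    Submodule.span ℝ {mode0, mode1cos, mode1sin, mode2cos, mode2sin} ≤ eigenspace 1 := by
  rw [Submodule.span_le]
  rintro u (rfl | rfl | rfl | rfl | rfl)
  -- The function φ₀ is paired with the angular factor cos(0 · x) = 1.
  · refine inEigenspace_of_separated ?_ isRadialMode_phi0 (isAngularMode_cos 0) contDiff_phi0
      (by fun_prop)
    funext q
    change phi0 (q 1) = _
    simp
  · refine inEigenspace_of_separated ?_ isRadialMode_phi1 (isAngularMode_cos 1) contDiff_phi1
      (by fun_prop)
    funext q
    change phi1 (q 1) * Real.cos (q 0) = _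
    simp
  · refine inEigenspace_of_separated ?_ isRadialMode_phi1 (isAngularMode_sin 1) contDiff_phi1
      (by fun_prop)
    funext q
    change phi1 (q 1) * Real.sin (q 0) = _
    simp
  · refine inEigenspace_of_separated ?_ isRadialMode_phi2 (isAngularMode_cos 2) contDiff_phi2
      (by fun_prop)
    funext q
    change phi2 (q 1) * Real.cos (2 * q 0) = _
    simp
  · refine inEigenspace_of_separated ?_ isRadialMode_phi2 (isAngularMode_sin 2) contDiff_phi2
      (by fun_prop)
    funext q
    change phi2 (q 1) * Real.sin (2 * q 0) = _
    simp

lemma mode0_ne_zero : mode0 ≠ 0 := by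
  intro h
  have h1 : phi0 0 = 0 := congrFun h (proj 0)
  simp [phi0, angle_zero] at h1

/-! ### There are no others -/

lemma InEigenspace.eq_zero_of_lt_one {μ : ℝ} {u : KleinBottle → ℝ} (h : InEigenspace μ u)
    (hμ : μ < 1) (hμ0 : μ ≠ 0) : u = 0 := by
  have hU := h.isPlaneEigenfunction
  have hc := fun m (y : ℝ) =>
    congrFun ((hU.isRadialMode (isAngularMode_cos m)).eq_zero_of_lt_one hμ hμ0) y
  have hs := fun m (y : ℝ) =>
    congrFun ((hU.isRadialMode (isAngularMode_sin m)).eq_zero_of_lt_one hμ hμ0) y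
  simp only [Pi.zero_apply] at hc hs
  funext k
  obtain ⟨q, rfl⟩ := proj_surjective k
  have hq : q = ![q 0, q 1] := by ext i; fin_cases i <;> rfl
  have := eq_trig_poly_of_coeff_eq_zero
    (continuous_slice_fst hU.contDiff.continuous (q 1)) (fun x => hU.periodic_fst x _)
    (fun m _ => hc m _) (fun m _ => hs m _) (q 0)
  rw [hc, hc, hs, hc, hs, ← hq] at this
  simpa using this

lemma InEigenspace.mem_span_modes {u : KleinBottle → ℝ} (h : InEigenspace 1 u) :
    u ∈ Submodule.span ℝ {mode0, mode1cos, mode1sin, mode2cos, mode2sin} := by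
  have hU := h.isPlaneEigenfunction
  have hc := fun m => hU.isRadialMode (isAngularMode_cos m)
  have hs := fun m => hU.isRadialMode (isAngularMode_sin m)
  obtain ⟨c₀, h0⟩ := (hc 0).exists_eq_mul_phi0
  obtain ⟨c₁, h1⟩ := (hc 1).exists_eq_mul_phi1
  obtain ⟨s₁, h2⟩ := (hs 1).exists_eq_mul_phi1
  obtain ⟨c₂, h3⟩ := (hc 2).exists_eq_mul_phi2
  obtain ⟨s₂, h4⟩ := (hs 2).exists_eq_mul_phi2
  -- This is the Fourier normalization; the factor 2 in the nonconstant terms comes from pairing the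
  -- indices m and -m.
  set t := 1 / (2 * Real.pi)
  have hu : u = (t * c₀) • mode0 + (2 * t * c₁) • mode1cos + (2 * t * s₁) • mode1sin +
      (2 * t * c₂) • mode2cos + (2 * t * s₂) • mode2sin := by
    funext k
    obtain ⟨q, rfl⟩ := proj_surjective k
    have hq : q = ![q 0, q 1] := by ext i; fin_cases i <;> rfl
    have := eq_trig_poly_of_coeff_eq_zero
      (continuous_slice_fst hU.contDiff.continuous (q 1)) (fun x => hU.periodic_fst x _)
      (fun m hm => congrFun ((hc m).eq_zero_of_three_le hm) _)
      (fun m hm => congrFun ((hs m).eq_zero_of_three_le hm) _) (q 0)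
    rw [h0, h1, h2, h3, h4, ← hq] at this
    refine this.trans ?_
    change _ = t * c₀ * phi0 (q 1) + 2 * t * c₁ * (phi1 (q 1) * Real.cos (q 0)) +
      2 * t * s₁ * (phi1 (q 1) * Real.sin (q 0)) +
      2 * t * c₂ * (phi2 (q 1) * Real.cos (2 * q 0)) +
      2 * t * s₂ * (phi2 (q 1) * Real.sin (2 * q 0))
    push_cast
    rw [one_mul]
    ring
  have hm : ∀ v ∈ ({mode0, mode1cos, mode1sin, mode2cos, mode2sin} : Set (KleinBottle → ℝ)),
      ∀ c : ℝ, c • v ∈ Submodule.span ℝ {mode0, mode1cos, mode1sin, mode2cos, mode2sin} :=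
    fun v hv c => Submodule.smul_mem _ _ (Submodule.subset_span hv)
  rw [hu]
  exact add_mem (add_mem (add_mem (add_mem (hm _ (by simp) _) (hm _ (by simp) _))
    (hm _ (by simp) _)) (hm _ (by simp) _)) (hm _ (by simp) _)

end ExtremalKlein

theorem proposition3p1 :
    IsLeast {μ : ℝ | μ ≠ 0 ∧ ExtremalKlein.IsEigenvalue μ} 1 ∧
    {u : ExtremalKlein.KleinBottle → ℝ | ExtremalKlein.InEigenspace 1 u} =
      (Submodule.span ℝ {ExtremalKlein.mode0, ExtremalKlein.mode1cos, ExtremalKlein.mode1sin,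
        ExtremalKlein.mode2cos, ExtremalKlein.mode2sin} :
        Set (ExtremalKlein.KleinBottle → ℝ)) := by
  refine ⟨⟨⟨one_ne_zero, ExtremalKlein.mode0, ExtremalKlein.mode0_ne_zero,
    ExtremalKlein.span_modes_le (Submodule.subset_span (by simp))⟩, ?_⟩, ?_⟩
  -- Negative μ need no separate argument: the comparison only asks for μ < 1 and μ ≠ 0.
  · rintro μ ⟨hμ0, u, hu, h⟩
    by_contra hlt
    exact hu (h.eq_zero_of_lt_one (not_le.1 hlt) hμ0)
  · exact Set.Subset.antisymm (fun u hu => hu.mem_span_modes)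
      fun u hu => ExtremalKlein.span_modes_le hu
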